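/- Let $K$ be a field, $S=K[x_1,\dots,x_n]$ and $t\ge 0$ an integer. A monomial $x_{i_1}x_{i_2}\cdots x_{i_d}$ with $i_1\le i_2\le\cdots\le i_d$ is called $t$-spread if $i_k-i_{k-1}\ge t$ for $2\le k\le d$. An ideal $I\subset S$ is called $t$-spread strongly stable if it is generated by $t$-spread monomials and, for every $t$-spread monomial $u\in I$, every $j$ such that $x_j$ divides $u$ and every $i<j$ such that $x_i(u/x_j)$ is $t$-spread, one has $x_i(u/x_j)\in I$. Theorem. Let $I\subset S$ be a $t$-spread strongly stable ideal, and let $u_1>u_2>\cdots>u_m$ be its minimal monomial generators, listed in decreasing order with respect to the pure lexicographic order with $x_1>x_2>\cdots>x_n$. Then $I$ has linear quotients with respect to this order: for every $1\le r\le m$, the colon ideal $(u_1,\dots,u_{r-1}):u_r$ is generated by a (possibly empty) set of variables. In particular, $I$ is componentwise linear: for every $j\ge 0$, the ideal $I_{\langle j\rangle}$ generated by all homogeneous polynomials of degree $j$ in $I$ has a $j$-linear resolution, i.e. a graded free resolution of the form $\cdots\to S(-j-2)^{b_2}\to S(-j-1)^{b_1}\to S(-j)^{b_0}\to I_{\langle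 j\rangle}\to 0$. -/

import Mathlib

open MvPolynomial

namespace TSpread

/-- The monomial `x ^ u` of `K[x_1, …, x_n]` with exponent vector `u`. The variables are indexed by
`Fin n`, so `x_1, …, x_n` are `X 0, …, X (n - 1)`. -/
noncomputable def mon (K : Type*) [Field K] {n : ℕ} (u : Fin n →₀ ℕ) : MvPolynomial (Fin n) K :=
  monomial u 1

/-- Writing `x ^ u = x_{i_1} ⋯ x_{i_d}` with `i_1 ≤ ⋯ ≤ i_d`, the monomial is `t`-spread if
`i_k - i_{k-1} ≥ t` for `2 ≤ k ≤ d`. -/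
def IsTSpread (t : ℕ) {n : ℕ} (u : Fin n →₀ ℕ) : Prop :=
  ((Finsupp.toMultiset u).sort (· ≤ ·)).IsChain (fun i j => (i : ℕ) + t ≤ (j : ℕ))

/-- An ideal generated by `t`-spread monomials. -/
def IsTSpreadIdeal (t : ℕ) {K : Type*} [Field K] {n : ℕ}
    (I : Ideal (MvPolynomial (Fin n) K)) : Prop :=
  ∃ A : Set (Fin n →₀ ℕ), (∀ u ∈ A, IsTSpread t u) ∧ I = Ideal.span (mon K '' A)

/-- A `t`-spread monomial ideal `I` such that, for every `t`-spread monomial `u ∈ I`, every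
`j ∈ supp u` and every `i < j` for which `x_i (u / x_j)` is `t`-spread, one has
`x_i (u / x_j) ∈ I`. -/
structure IsTSpreadStronglyStable (t : ℕ) {K : Type*} [Field K] {n : ℕ}
    (I : Ideal (MvPolynomial (Fin n) K)) : Prop where
  isTSpreadIdeal : IsTSpreadIdeal t I
  exchange : ∀ u : Fin n →₀ ℕ, IsTSpread t u → mon K u ∈ I →
    ∀ j ∈ u.support, ∀ i : Fin n, i < j →
      IsTSpread t (Finsupp.single i 1 + (u - Finsupp.single j 1)) →
        mon K (Finsupp.single i 1 + (u - Finsupp.single j 1)) ∈ I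

/-- The set `G(I)` of (exponent vectors of) the minimal monomial generators of a monomial
ideal `I`: the monomials in `I` that are minimal with respect to divisibility. -/
def minGens {K : Type*} [Field K] {n : ℕ} (I : Ideal (MvPolynomial (Fin n) K)) :
    Set (Fin n →₀ ℕ) :=
  {u | Minimal (fun v => mon K v ∈ I) u}

/-- `I` has linear quotients with respect to the order `u_1, …, u_m` of its minimal monomial
generators: the list enumerates `G(I)` without repetition, and each colon ideal
`(u_1, …, u_{r-1}) : u_r` is generated by a set of variables. -/
structure HasLinearQuotientsWrt {K : Type*} [Field K] {n : ℕ}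
    (I : Ideal (MvPolynomial (Fin n) K)) (l : List (Fin n →₀ ℕ)) : Prop where
  nodup : l.Nodup
  mem_iff : ∀ u, u ∈ l ↔ u ∈ minGens I
  colon : ∀ (r : ℕ) (hr : r < l.length), ∃ A : Set (Fin n),
    (Ideal.span (mon K '' {v | v ∈ l.take r})).colon {mon K l[r]} =
      Ideal.span ((X : Fin n → MvPolynomial (Fin n) K) '' A)

/-- The list is strictly decreasing in the pure lexicographic order induced by
`x_1 > x_2 > ⋯ > x_n`. -/
def IsLexDecreasing {n : ℕ} (l : List (Fin n →₀ ℕ)) : Prop :=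
  l.Pairwise (fun u v => toLex v < toLex u)

/-- `I` has a `d`-linear resolution: a graded free resolution of the form
`⋯ → S(-d-2)^{b_2} → S(-d-1)^{b_1} → S(-d)^{b_0} → I → 0`. In bases, the augmentation is given by
forms of degree `d` and every differential by a matrix of linear forms; such a resolution is
automatically minimal. -/
def HasLinearResolution {K : Type*} [Field K] {n : ℕ} (d : ℕ)
    (I : Ideal (MvPolynomial (Fin n) K)) : Prop :=
  ∃ (b : ℕ → ℕ) (f : Fin (b 0) → MvPolynomial (Fin n) K)
    (D : ∀ i : ℕ, Matrix (Fin (b i)) (Fin (b (i + 1))) (MvPolynomial (Fin n) K)),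
    (∀ k, (f k).IsHomogeneous d) ∧
    (∀ i k l, (D i k l).IsHomogeneous 1) ∧
    LinearMap.range (Fintype.linearCombination (MvPolynomial (Fin n) K) f) = I ∧
    Function.Exact (D 0).mulVecLin (Fintype.linearCombination (MvPolynomial (Fin n) K) f) ∧
    ∀ i, Function.Exact (D (i + 1)).mulVecLin (D i).mulVecLin

/-- The ideal `I_{⟨j⟩}` generated by all homogeneous polynomials of degree `j` in `I`. -/
noncomputable def component {K : Type*} [Field K] {n : ℕ} (I : Ideal (MvPolynomial (Fin n) K)) (j : ℕ) :
    Ideal (MvPolynomial (Fin n) K) :=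
  Ideal.span {f | f ∈ I ∧ f.IsHomogeneous j}

/-- `I` is componentwise linear: `I_{⟨j⟩}` has a `j`-linear resolution for every `j`. -/
def IsComponentwiseLinear {K : Type*} [Field K] {n : ℕ}
    (I : Ideal (MvPolynomial (Fin n) K)) : Prop :=
  ∀ j : ℕ, HasLinearResolution j (component I j)

end TSpread

namespace TSpread

/-! ### Monomial ideals, minimal generators and colons by a monomial. -/

section Monomials

variable {K : Type*} [Field K] {n : ℕ}

/-! Let u < v be minimal generators, x_i the first variable where they differ, x_b the next variable
of u after x_i. Then x_i u / x_b is t-spread, hence in I. Minimality of u forces every minimal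
generator w dividing it to agree with u before x_i and to contain x_i once more. So w > u, w divides
x_i u, and x_i divides v / gcd(u, v): the colons are generated by variables
(`IsTSpreadStronglyStable.exists_exchange`, `colon_mon_eq`).

For componentwise linearity, order the degree j monomials of I by the lex-greatest minimal generator
dividing each, ties broken by lex. The exchange lifts from generators to their multiples, so this
order also gives linear quotients. Since all degrees agree, the relations witnessing the colons are
linear. Finally, the property `HasLinearRelations` passes from a family to its linear syzygies,
which generate all syzygies (`HasLinearRelations.exists_syzygies`); iterating builds the linear
resolution. -/

theorem mon_mem_span_iff {A : Set (Fin n →₀ ℕ)} {u : Fin n →₀ ℕ} :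
    mon K u ∈ Ideal.span (mon K '' A) ↔ ∃ a ∈ A, a ≤ u := by
  classical
  have h := mem_ideal_span_monomial_image (R := K) (x := monomial u 1) (s := A)
  rw [support_monomial, if_neg one_ne_zero] at h
  simp only [Finset.mem_singleton, forall_eq] at h
  exact h

theorem mon_mul (u v : Fin n →₀ ℕ) : mon K u * mon K v = mon K (u + v) := by
  simp [mon, monomial_mul]

theorem mon_mem_of_le {I : Ideal (MvPolynomial (Fin n) K)} {u v : Fin n →₀ ℕ}
    (hu : mon K u ∈ I) (h : u ≤ v) : mon K v ∈ I := by
  rw [← tsub_add_cancel_of_le h, ← mon_mul]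
  exact I.mul_mem_left _ hu

theorem X_mul_mon (i : Fin n) (u : Fin n →₀ ℕ) :
    X i * mon K u = mon K (Finsupp.single i 1 + u) := by
  rw [← mon_mul]; rfl

theorem mon_mem_of_mem_minGens {I : Ideal (MvPolynomial (Fin n) K)} {u : Fin n →₀ ℕ}
    (hu : u ∈ minGens I) : mon K u ∈ I :=
  (show Minimal _ u from hu.out).prop

theorem eq_of_mem_minGens_of_le {I : Ideal (MvPolynomial (Fin n) K)} {u v : Fin n →₀ ℕ}
    (hu : u ∈ minGens I) (hv : mon K v ∈ I) (hle : v ≤ u) : u = v :=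
  ((show Minimal _ u from hu.out).eq_of_le hv hle).symm

theorem exists_minGens_le {I : Ideal (MvPolynomial (Fin n) K)} {u : Fin n →₀ ℕ}
    (hu : mon K u ∈ I) : ∃ v ∈ minGens I, v ≤ u := by
  obtain ⟨v, hv, hm⟩ := exists_minimal_le_of_wellFoundedLT (fun v => mon K v ∈ I) u hu
  exact ⟨v, hm, hv⟩

/-- Dickson's lemma: minimal elements form an antichain in a well-quasi-order. -/
theorem finite_minGens (I : Ideal (MvPolynomial (Fin n) K)) : (minGens I).Finite :=
  WellQuasiOrderedLE.finite_of_isAntichain (setOfPred_minimal_antichain _)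

/-- If every generator `x ^ v` of a monomial ideal can be traded for a variable `x_i` dividing
`x ^ v / gcd (x ^ u, x ^ v)` and multiplying `x ^ u` into the ideal, then the colon by `x ^ u` is
generated by variables. -/
theorem colon_mon_eq {B : Set (Fin n →₀ ℕ)} {u : Fin n →₀ ℕ}
    (h : ∀ v ∈ B, ∃ i, u i < v i ∧ ∃ w ∈ B, w ≤ Finsupp.single i 1 + u) :
    (Ideal.span (mon K '' B)).colon {mon K u} =
      Ideal.span ((X : Fin n → MvPolynomial (Fin n) K) ''
        {i | ∃ w ∈ B, w ≤ Finsupp.single i 1 + u}) := by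
  apply le_antisymm
  · intro g hg
    rw [Submodule.mem_colon_singleton, smul_eq_mul] at hg
    rw [mem_ideal_span_X_image]
    intro m hm
    have hg' := mem_ideal_span_monomial_image.1 hg (m + u)
      (by rw [mem_support_iff, mon, coeff_mul_monomial, mul_one]; exact mem_support_iff.1 hm)
    obtain ⟨v, hv, hle⟩ := hg'
    obtain ⟨i, hi, hw⟩ := h v hv
    refine ⟨i, hw, fun h0 => ?_⟩
    have := hle i
    simp [h0] at this
    omega
  · rw [Ideal.span_le]
    rintro _ ⟨i, hi, rfl⟩
    rw [SetLike.mem_coe, Submodule.mem_colon_singleton, smul_eq_mul, X_mul_mon]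
    exact mon_mem_span_iff.2 hi

end Monomials

/-! ### Spread monomials and the exchange of a variable. -/

section Spread

variable {t n : ℕ}

/-- The gap relation is transitive, so consecutive gaps control all pairs, and a two-term sublist of
the sorted list is a factor x_a x_b with a ≤ b. The case a = b records squares. -/
theorem isTSpread_iff {u : Fin n →₀ ℕ} :
    IsTSpread t u ↔ ∀ a b : Fin n, a ≤ b →
      Finsupp.single a 1 + Finsupp.single b 1 ≤ u → (a : ℕ) + t ≤ b := by
  have : Trans (fun i j : ℕ => i + t ≤ j) (fun i j : ℕ => i + t ≤ j)
      (fun i j : ℕ => i + t ≤ j) := ⟨fun h₁ h₂ => by omega⟩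
  have hmap : IsTSpread t u ↔ (((Finsupp.toMultiset u).sort (· ≤ ·)).map Fin.val).IsChain
      (fun i j => i + t ≤ j) := by
    -- In the definition the sorted list is coerced to a list of naturals through a monadic bind.
    rw [← List.flatMap_pure_eq_map]; rfl
  rw [hmap, List.isChain_iff_pairwise, List.pairwise_map, List.pairwise_iff_forall_sublist]
  have key : ∀ a b : Fin n, [a, b].Sublist ((Finsupp.toMultiset u).sort (· ≤ ·)) ↔
      a ≤ b ∧ Finsupp.single a 1 + Finsupp.single b 1 ≤ u := by
    intro a b
    have h1 : Finsupp.single a 1 + Finsupp.single b 1 ≤ u ↔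
        (([a, b] : List (Fin n)) : Multiset (Fin n)) ≤ Finsupp.toMultiset u := by
      rw [← Finsupp.orderIsoMultiset.le_iff_le]
      simp only [Finsupp.coe_orderIsoMultiset, map_add, Finsupp.toMultiset_single, one_smul]
      rfl
    rw [h1]
    constructor
    · intro h
      refine ⟨?_, ?_⟩
      · have := (Multiset.pairwise_sort (Finsupp.toMultiset u) (· ≤ ·)).sublist h
        simpa using this
      · rw [← Multiset.sort_eq (Finsupp.toMultiset u) (· ≤ ·)]
        exact h.subperm
    · rintro ⟨hab, h⟩
      rw [← Multiset.sort_eq (Finsupp.toMultiset u) (· ≤ ·), Multiset.coe_le] at h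
      exact List.sublist_of_subperm_of_pairwise h (by simpa using hab)
        (Multiset.pairwise_sort _ _)
  simp only [key, and_imp]

theorem IsTSpread.mono {u v : Fin n →₀ ℕ} (hv : IsTSpread t v) (h : u ≤ v) : IsTSpread t u :=
  isTSpread_iff.2 fun a b hab hu => isTSpread_iff.1 hv a b hab (hu.trans h)

theorem IsTSpread.add_le {u : Fin n →₀ ℕ} (hu : IsTSpread t u) {a b : Fin n} (hab : a < b)
    (ha : 0 < u a) (hb : 0 < u b) : (a : ℕ) + t ≤ b := by
  refine isTSpread_iff.1 hu a b hab.le fun c => ?_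
  simp only [Finsupp.add_apply, Finsupp.single_apply]
  split_ifs <;> subst_vars <;> omega

theorem IsTSpread.eq_zero_of_two_le {u : Fin n →₀ ℕ} (hu : IsTSpread t u) {a : Fin n}
    (ha : 2 ≤ u a) : t = 0 := by
  have := isTSpread_iff.1 hu a a le_rfl fun c => by
    simp only [Finsupp.add_apply, Finsupp.single_apply]
    split_ifs <;> subst_vars <;> omega
  omega

/-- If `x ^ u` is lexicographically smaller than `x ^ v`, first differing at the variable `x_i`, and
`x_b` is the next variable dividing `x ^ u`, then `x_i (x ^ u / x_b)` is `t`-spread. -/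
theorem IsTSpread.exchange {u v : Fin n →₀ ℕ} (hu : IsTSpread t u) (hv : IsTSpread t v)
    {i b : Fin n} (heq : ∀ a < i, u a = v a) (hi : u i < v i) (hib : i < b) (hb : 0 < u b)
    (hmin : ∀ c, i < c → 0 < u c → b ≤ c) :
    IsTSpread t (Finsupp.single i 1 + (u - Finsupp.single b 1)) := by
  have hval : ∀ c, (Finsupp.single i 1 + (u - Finsupp.single b 1) : Fin n →₀ ℕ) c =
      if c = i then u i + 1 else if c = b then u b - 1 else u c := by
    intro c
    simp only [Finsupp.add_apply, Finsupp.tsub_apply, Finsupp.single_apply]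
    split_ifs <;> subst_vars <;> omega
  rw [isTSpread_iff]
  intro a c hac h
  have ha : 0 < (Finsupp.single i 1 + (u - Finsupp.single b 1) : Fin n →₀ ℕ) a := by
    have := h a; simp only [Finsupp.add_apply, Finsupp.single_eq_same] at this ⊢; omega
  have hc : 0 < (Finsupp.single i 1 + (u - Finsupp.single b 1) : Fin n →₀ ℕ) c := by
    have := h c; simp only [Finsupp.add_apply, Finsupp.single_eq_same] at this ⊢; omega
  have hdiag : a = c → 2 ≤ (Finsupp.single i 1 + (u - Finsupp.single b 1) : Fin n →₀ ℕ) a := by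
    rintro rfl; have := h a; simp only [Finsupp.add_apply, Finsupp.single_eq_same] at this ⊢; omega
  rw [hval] at ha hc hdiag
  rcases hac.eq_or_lt with rfl | hlt
  -- A square in the new monomial comes from a square in v (at i) or in u (elsewhere), so t = 0.
  · have h2 := hdiag rfl
    by_cases hai : a = i
    · subst hai
      rw [if_pos rfl] at h2
      have := hv.eq_zero_of_two_le (a := a) (by omega)
      omega
    · rw [if_neg hai] at h2
      have := hu.eq_zero_of_two_le (a := a) (by split_ifs at h2 <;> subst_vars <;> omega)
      omega
  · have hpos : ∀ d, d ≠ i → 0 < (if d = i then u i + 1 else if d = b then u b - 1 else u d) →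
        0 < u d := by
      intro d hd h'; rw [if_neg hd] at h'; split_ifs at h' <;> subst_vars <;> omega
    by_cases hai : a = i
    · subst hai
      -- Here c ≥ b. If c = b, then x_b survives only if u_b ≥ 2, so t = 0; if c > b, the gap from i
      -- exceeds the gap from b.
      have hcu := hpos c hlt.ne' hc
      rcases (hmin c hlt hcu).eq_or_lt with rfl | hbc
      · rw [if_neg hlt.ne', if_pos rfl] at hc
        have := hu.eq_zero_of_two_le (a := b) (by omega)
        have : (a : ℕ) < b := hlt
        omega
      · have := hu.add_le hbc hb hcu
        have : (a : ℕ) < b := hib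
        omega
    · have hau := hpos a hai ha
      by_cases hci : c = i
      · subst hci
        -- Both x_a and x_i divide v, so the gap is read off there.
        rw [heq a hlt] at hau
        exact hv.add_le hlt hau (by omega)
      · exact hu.add_le hlt hau (hpos c hci hc)

end Spread

/-! ### Exchange between minimal generators and linear quotients. -/

section MinGens

variable {K : Type*} [Field K] {t n : ℕ} {I : Ideal (MvPolynomial (Fin n) K)}

theorem IsTSpreadIdeal.isTSpread (hI : IsTSpreadIdeal t I) {u : Fin n →₀ ℕ}
    (hu : u ∈ minGens I) : IsTSpread t u := by
  obtain ⟨A, hA, rfl⟩ := hI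
  obtain ⟨a, ha, hle⟩ := mon_mem_span_iff.1 (mon_mem_of_mem_minGens hu)
  rw [eq_of_mem_minGens_of_le hu (mon_mem_span_iff.2 ⟨a, ha, le_rfl⟩) hle]
  exact hA a ha

theorem IsTSpreadIdeal.mon_mem_of_mem_support (hI : IsTSpreadIdeal t I)
    {f : MvPolynomial (Fin n) K} (hf : f ∈ I) {m : Fin n →₀ ℕ} (hm : m ∈ f.support) :
    mon K m ∈ I := by
  obtain ⟨A, -, rfl⟩ := hI
  exact mon_mem_span_iff.2 (mem_ideal_span_monomial_image.1 hf m hm)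

/-- The exchange property between minimal generators behind linear quotients. -/
theorem IsTSpreadStronglyStable.exists_exchange (hI : IsTSpreadStronglyStable t I)
    {u v : Fin n →₀ ℕ} (hu : u ∈ minGens I) (hv : v ∈ minGens I) (huv : toLex u < toLex v) :
    ∃ i b, ∃ w ∈ minGens I, u i < v i ∧ i ≠ b ∧ 0 < u b ∧ toLex u < toLex w ∧
      w ≤ Finsupp.single i 1 + (u - Finsupp.single b 1) := by
  classical
  have hut := hI.isTSpreadIdeal.isTSpread hu
  have hvt := hI.isTSpreadIdeal.isTSpread hv
  obtain ⟨i, heq, hi⟩ := Finsupp.Lex.lt_iff.1 huv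
  replace heq : ∀ a < i, u a = v a := heq
  replace hi : u i < v i := hi
  -- Otherwise u would properly divide the minimal generator v.
  have hex : ∃ b, i < b ∧ 0 < u b := by
    by_contra! hcon
    have hle : u ≤ v := by
      intro c
      rcases lt_trichotomy c i with h | rfl | h
      · exact (heq c h).le
      · exact hi.le
      · exact (hcon c h).trans (Nat.zero_le _)
    rw [eq_of_mem_minGens_of_le hv (mon_mem_of_mem_minGens hu) hle] at hi
    exact lt_irrefl _ hi
  obtain ⟨b, ⟨hib, hb⟩, hmin⟩ := exists_minimal_of_wellFoundedLT (fun b => i < b ∧ 0 < u b) hex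
  replace hmin : ∀ c, i < c → 0 < u c → b ≤ c := fun c h1 h2 =>
    (le_total b c).elim id fun h => hmin ⟨h1, h2⟩ h
  have hst := hut.exchange hvt heq hi hib hb hmin
  obtain ⟨w, hw, hle⟩ := exists_minGens_le
    (hI.exchange u hut (mon_mem_of_mem_minGens hu) b (Finsupp.mem_support_iff.2 hb.ne') i hib hst)
  have hval : ∀ c, w c ≤ if c = i then u i + 1 else if c = b then u b - 1 else u c := by
    intro c
    refine (hle c).trans ?_
    simp only [Finsupp.add_apply, Finsupp.tsub_apply, Finsupp.single_apply]
    split_ifs <;> subst_vars <;> omega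
  have hwb : w b < u b := by
    have := hval b; rw [if_neg hib.ne', if_pos rfl] at this; omega
  have hnot : ∀ x, mon K x ∈ I → x b < u b → ¬ x ≤ u := by
    intro x hx hlt hxu
    rw [← eq_of_mem_minGens_of_le hu hx hxu] at hlt
    exact lt_irrefl _ hlt
  -- Without the extra x_i, w would divide u properly, the exponent at b having dropped.
  have hwi : w i = u i + 1 := by
    by_contra hne
    have h1 := hval i
    rw [if_pos rfl] at h1
    refine hnot w (mon_mem_of_mem_minGens hw) hwb fun c => ?_
    have := hval c
    split_ifs at this <;> subst_vars <;> omega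
  refine ⟨i, b, w, hw, hi, hib.ne, hb, Finsupp.Lex.lt_iff.2 ⟨i, fun a ha => ?_, ?_⟩, hle⟩
  · change u a = w a
    by_contra hne
    have h1 := hval a
    rw [if_neg ha.ne, if_neg (ha.trans hib).ne] at h1
    -- If w falls short of u at some a < i, then x_a w / x_i divides u. It is therefore t-spread,
    -- lies in I by a second exchange, and contradicts minimality of u at b.
    have hle' : Finsupp.single a 1 + (w - Finsupp.single i 1) ≤ u := by
      intro c
      have := hval c
      simp only [Finsupp.add_apply, Finsupp.tsub_apply, Finsupp.single_apply]
      split_ifs at this ⊢ <;> subst_vars <;> omega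
    refine hnot _ (hI.exchange w (hI.isTSpreadIdeal.isTSpread hw) (mon_mem_of_mem_minGens hw) i
      (Finsupp.mem_support_iff.2 (by omega)) a ha (hut.mono hle')) ?_ hle'
    simp only [Finsupp.add_apply, Finsupp.tsub_apply, Finsupp.single_apply]
    rw [if_neg (ha.trans hib).ne, if_neg hib.ne]
    omega
  · change u i < w i
    omega

theorem IsTSpreadStronglyStable.exists_hasLinearQuotientsWrt
    (hI : IsTSpreadStronglyStable t I) :
    ∃ l : List (Fin n →₀ ℕ), IsLexDecreasing l ∧ HasLinearQuotientsWrt I l := by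
  classical
  let s : Finset (Lex (Fin n →₀ ℕ)) := (finite_minGens I).toFinset.map toLex.toEmbedding
  have hmem : ∀ u, u ∈ (s.sort (· ≥ ·)).map ofLex ↔ u ∈ minGens I := by
    intro u
    rw [List.mem_map]
    simp [s]
  have hdec : IsLexDecreasing ((s.sort (· ≥ ·)).map ofLex) :=
    List.pairwise_map.2 s.sortedGT_sort.pairwise
  refine ⟨_, hdec, (s.sort_nodup _).map ofLex.injective, hmem, ?_⟩
  generalize (s.sort (· ≥ ·)).map ofLex = l at hmem hdec
  intro r hr
  -- The generators listed earlier are exactly the lex-larger ones.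
  have htake : ∀ w, w ∈ l.take r ↔ w ∈ l ∧ toLex l[r] < toLex w := by
    intro w
    constructor
    · intro hw
      refine ⟨List.mem_of_mem_take hw, ?_⟩
      obtain ⟨k, hk, rfl⟩ := List.mem_take_iff_getElem.1 hw
      exact List.pairwise_iff_getElem.1 hdec _ _ _ hr (by omega)
    · rintro ⟨hw, hlt⟩
      obtain ⟨k, hk, rfl⟩ := List.mem_iff_getElem.1 hw
      refine List.mem_take_iff_getElem.2 ⟨k, ?_, rfl⟩
      rw [lt_min_iff]
      refine ⟨?_, hk⟩
      by_contra! hrk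
      rcases hrk.eq_or_lt with rfl | hrk
      · exact lt_irrefl _ hlt
      · exact lt_asymm hlt (List.pairwise_iff_getElem.1 hdec _ _ hr hk hrk)
  refine ⟨_, colon_mon_eq fun v hv => ?_⟩
  obtain ⟨hvl, hlt⟩ := (htake v).1 hv
  obtain ⟨i, b, w, hw, hi, -, -, hlw, hle⟩ :=
    hI.exists_exchange ((hmem _).1 (List.getElem_mem hr)) ((hmem v).1 hvl) hlt
  exact ⟨i, hi, w, (htake w).2 ⟨(hmem w).2 hw, hlw⟩,
    hle.trans (add_le_add_right tsub_le_self _)⟩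

end MinGens

end TSpread

namespace TSpread

/-! ### From linear relations to linear resolutions. -/

section LinearQuotients

variable {K : Type*} [Field K] {n : ℕ} {N : Type*} [AddCommGroup N]
  [Module (MvPolynomial (Fin n) K) N]

/-- A family in an `S`-module, indexed by a linear order, has *linear quotients with linear
relations* if each colon of the span of the earlier members by the next one is generated by a set
of variables, and the membership of these variables in the colon is witnessed by linear forms. -/
def HasLinearRelations {β : Type*} [Fintype β] [LinearOrder β] (f : β → N) : Prop :=
  ∀ r, ∃ A : Set (Fin n),
    (∀ g : MvPolynomial (Fin n) K,
      g • f r ∈ Submodule.span (MvPolynomial (Fin n) K) (f '' Set.Iio r) →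
      g ∈ Ideal.span ((X : Fin n → MvPolynomial (Fin n) K) '' A)) ∧
    ∀ x ∈ A, ∃ c : β → MvPolynomial (Fin n) K, (∀ s, (c s).IsHomogeneous 1) ∧
      (∀ s, ¬ s < r → c s = 0) ∧ (X x : MvPolynomial (Fin n) K) • f r = ∑ s, c s • f s

theorem HasLinearRelations.comp_orderIso {β γ : Type*} [Fintype β] [LinearOrder β] [Fintype γ]
    [LinearOrder γ] {f : β → N} (hf : HasLinearRelations (K := K) (n := n) f) (e : γ ≃o β) :
    HasLinearRelations (K := K) (n := n) (f ∘ e) := by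
  intro r
  obtain ⟨A, h1, h2⟩ := hf (e r)
  refine ⟨A, fun g hg => h1 g ?_, fun x hx => ?_⟩
  · rwa [Set.image_comp, e.image_Iio] at hg
  · obtain ⟨c, hc1, hc2, hc3⟩ := h2 x hx
    refine ⟨c ∘ e, fun s => hc1 _, fun s hs => hc2 _ (by simpa using hs), ?_⟩
    rw [Function.comp_apply, hc3]
    exact (Equiv.sum_comp e.toEquiv fun s => c s • f s).symm

theorem homogeneousComponent_add_mul {d e : ℕ} (p : MvPolynomial (Fin n) K)
    {q : MvPolynomial (Fin n) K} (hq : q.IsHomogeneous e) :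
    homogeneousComponent (d + e) (p * q) = homogeneousComponent d p * q := by
  let := gradedAlgebra (σ := Fin n) (R := K)
  simp_rw [← decomposition.decompose'_apply]
  exact DirectSum.coe_decompose_mul_add_of_right_mem (homogeneousSubmodule (Fin n) K)
    (i := d) (a := p) ((mem_homogeneousSubmodule _ _).2 hq)

/-- Replace the coefficients of any combination by their degree d components; the other degrees
cannot contribute to v. -/
theorem exists_linear_combination_of_mem_span {κ τ : Type*} [Fintype τ]
    {z : τ → κ → MvPolynomial (Fin n) K} {d e : ℕ} (hz : ∀ p k, (z p k).IsHomogeneous e)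
    {B : Set τ} {v : κ → MvPolynomial (Fin n) K} (hv : ∀ k, (v k).IsHomogeneous (d + e))
    (hmem : v ∈ Submodule.span (MvPolynomial (Fin n) K) (z '' B)) :
    ∃ c : τ → MvPolynomial (Fin n) K, (∀ p, (c p).IsHomogeneous d) ∧ (∀ p ∉ B, c p = 0) ∧
      v = ∑ p, c p • z p := by
  classical
  obtain ⟨l, hl, rfl⟩ := (Finsupp.mem_span_image_iff_linearCombination _).1 hmem
  refine ⟨fun p => homogeneousComponent d (l p), fun p => homogeneousComponent_isHomogeneous _ _,
    fun p hp => ?_, ?_⟩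
  · have : l p = 0 := by
      by_contra h
      exact hp ((Finsupp.mem_supported _ _).1 hl (Finsupp.mem_support_iff.2 h))
    simp [this]
  · ext1 k
    have hk := hv k
    have heq : (Finsupp.linearCombination (MvPolynomial (Fin n) K) z l) k =
        ∑ p, l p * z p k := by
      rw [Finsupp.linearCombination_apply, Finsupp.sum_fintype _ _ (by simp)]
      simp
    rw [heq] at hk ⊢
    rw [← homogeneousComponent_of_mem (m := d + e) ((mem_homogeneousSubmodule _ _).2 hk) |>.trans
      (if_pos rfl), map_sum]
    simp [homogeneousComponent_add_mul _ (hz _ k)]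

/-- A variable outside A is a nonzerodivisor modulo the variables in A. -/
theorem mem_span_X_of_mul_X_mem {A : Set (Fin n)} {x : Fin n} (hx : x ∉ A)
    {g : MvPolynomial (Fin n) K}
    (hg : g * X x ∈ Ideal.span ((X : Fin n → MvPolynomial (Fin n) K) '' A)) :
    g ∈ Ideal.span ((X : Fin n → MvPolynomial (Fin n) K) '' A) := by
  rw [mem_ideal_span_X_image] at hg ⊢
  intro m hm
  obtain ⟨i, hi, hne⟩ := hg (m + Finsupp.single x 1) (by
    rw [mem_support_iff, coeff_mul_X]; exact mem_support_iff.1 hm)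
  refine ⟨i, hi, ?_⟩
  have hix : x ≠ i := by rintro rfl; exact hx hi
  simpa [Finsupp.single_apply, hix] using hne

/-- Linear syzygies `x e_r - ∑ s < r, c_s e_s` of a family `f` form a family of the same kind, and
generate all syzygies of `f`. -/
theorem HasLinearRelations.exists_syzygies {b : ℕ} {f : Fin b → N}
    (hf : HasLinearRelations (K := K) (n := n) f) :
    ∃ (b' : ℕ) (D : Matrix (Fin b) (Fin b') (MvPolynomial (Fin n) K)),
      (∀ k l, (D k l).IsHomogeneous 1) ∧
      Function.Exact D.mulVecLin (Fintype.linearCombination (MvPolynomial (Fin n) K) f) ∧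
      HasLinearRelations (K := K) (n := n) D.col := by
  classical
  choose A hA hc using hf
  choose! c hc1 hc2 hc3 using hc
  let S := MvPolynomial (Fin n) K
  -- One syzygy per row r and colon variable x, ordered by row and then by variable.
  let T := {p : Fin b ×ₗ Fin n // (ofLex p).2 ∈ A (ofLex p).1}
  let _ : Fintype T := Fintype.ofFinite T
  let row : T → Fin b := fun p => (ofLex p.1).1
  let var : T → Fin n := fun p => (ofLex p.1).2
  have hvar : ∀ p : T, var p ∈ A (row p) := fun p => p.2
  let z : T → Fin b → S := fun p => Pi.single (row p) (X (var p)) - c (row p) (var p)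
  have hlt : ∀ p q : T, p < q ↔ row p < row q ∨ row p = row q ∧ var p < var q := fun p q =>
    Prod.Lex.lt_iff
  have z_hom : ∀ p k, (z p k).IsHomogeneous 1 := by
    intro p k
    refine IsHomogeneous.sub ?_ (hc1 _ _ (hvar p) k)
    by_cases hk : k = row p
    · subst hk; simpa using isHomogeneous_X K _
    · rw [Pi.single_eq_of_ne hk]; exact isHomogeneous_zero _ _ _
  have z_row : ∀ p, z p (row p) = X (var p) := by
    intro p; simp [z, hc2 _ _ (hvar p) (row p) (lt_irrefl _)]
  have z_gt : ∀ p k, row p < k → z p k = 0 := by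
    intro p k hk; simp [z, hc2 _ _ (hvar p) k hk.not_gt, Pi.single_eq_of_ne hk.ne']
  have z_syz : ∀ p, Fintype.linearCombination S f (z p) = 0 := by
    intro p
    rw [map_sub, Fintype.linearCombination_apply_single, hc3 _ _ (hvar p),
      Fintype.linearCombination_apply, sub_self]
  have span_le : ∀ (M : ℕ), Submodule.span S (z '' {p | (row p : ℕ) < M}) ≤
      LinearMap.ker (Fintype.linearCombination S f) ⊓
        ⨅ k : {k : Fin b // M ≤ k}, LinearMap.ker (LinearMap.proj (R := S) (φ := fun _ => S) k.1) := by
    intro M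
    rw [Submodule.span_le]
    rintro _ ⟨p, hp, rfl⟩
    refine ⟨z_syz p, ?_⟩
    rw [SetLike.mem_coe, Submodule.mem_iInf]
    rintro ⟨k, hk⟩
    exact z_gt p k (Fin.lt_def.2 (lt_of_lt_of_le (show (row p : ℕ) < M from hp) hk))
  -- Elimination from the top: the last coefficient of a syzygy lies in a colon ideal, so a
  -- combination of the `z p` cancels it.
  have gen : ∀ M : ℕ, ∀ g : Fin b → S, Fintype.linearCombination S f g = 0 →
      (∀ k : Fin b, M ≤ k → g k = 0) → g ∈ Submodule.span S (z '' {p | (row p : ℕ) < M}) := by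
    intro M
    induction M with
    | zero =>
      intro g _ h0
      rw [show g = 0 from funext fun k => h0 k (Nat.zero_le _)]
      exact zero_mem _
    | succ M ih =>
      intro g hg h0
      have hmono : Submodule.span S (z '' {p | (row p : ℕ) < M}) ≤
          Submodule.span S (z '' {p | (row p : ℕ) < M + 1}) :=
        Submodule.span_mono (Set.image_mono fun p (hp : (row p : ℕ) < M) => Nat.lt_succ_of_lt hp)
      by_cases hM : M < b
      swap
      · exact hmono (ih g hg fun k hk => absurd k.2 (by omega))
      let r : Fin b := ⟨M, hM⟩
      have hgr : g r ∈ Ideal.span ((X : Fin n → S) '' A r) := by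
        apply hA r
        have hsum := hg
        rw [Fintype.linearCombination_apply, ← Finset.add_sum_erase _ _ (Finset.mem_univ r)] at hsum
        rw [eq_neg_of_add_eq_zero_left hsum]
        refine neg_mem (sum_mem fun s hs => ?_)
        rcases lt_or_ge s r with hsr | hsr
        · exact Submodule.smul_mem _ _ (Submodule.subset_span ⟨s, hsr, rfl⟩)
        · rw [h0 s, zero_smul]
          · exact zero_mem _
          · exact Nat.succ_le_of_lt (Fin.lt_def.1 (hsr.lt_of_ne (Finset.ne_of_mem_erase hs).symm))
      have hle : Ideal.span ((X : Fin n → S) '' A r) ≤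
          (Submodule.span S (z '' {p | (row p : ℕ) < M + 1})).map
            (LinearMap.proj (R := S) (φ := fun _ => S) r) := by
        refine Ideal.span_le.2 ?_
        rintro _ ⟨x, hx, rfl⟩
        let p : T := ⟨toLex (r, x), hx⟩
        exact ⟨z p, Submodule.subset_span ⟨p, Nat.lt_succ_self M, rfl⟩, z_row p⟩
      obtain ⟨q, hq, hqr⟩ := hle hgr
      obtain ⟨hq1, hq2⟩ := span_le (M + 1) hq
      rw [SetLike.mem_coe, Submodule.mem_iInf] at hq2
      rw [← sub_add_cancel g q]
      refine add_mem (hmono (ih _ ?_ fun k hk => ?_)) hq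
      · rw [map_sub, hg, LinearMap.mem_ker.1 hq1, sub_self]
      · rcases hk.eq_or_lt with hk | hk
        · have : k = r := Fin.ext hk.symm
          rw [this, Pi.sub_apply, ← hqr]
          exact sub_self _
        · rw [Pi.sub_apply, h0 k hk, show q k = 0 from hq2 ⟨k, hk⟩, sub_self]
  have z_rel : HasLinearRelations (K := K) (n := n) z := by
    intro p
    -- In coordinate `row p`, earlier syzygies are 0 or a smaller variable of the same row, while `z
    -- p` is `X (var p)`, which cancels.
    refine ⟨{y | y ∈ A (row p) ∧ y < var p}, fun g hg => ?_, ?_⟩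
    · refine mem_span_X_of_mul_X_mem (x := var p) (fun h => lt_irrefl _ h.2) ?_
      have hle : Submodule.span S (z '' Set.Iio p) ≤
          Submodule.comap (M₂ := S)
            (LinearMap.proj (R := S) (φ := fun _ => S) (row p))
            (Ideal.span ((X : Fin n → S) '' {y | y ∈ A (row p) ∧ y < var p})) := by
        refine Submodule.span_le.2 ?_
        rintro _ ⟨q, hq, rfl⟩
        change z q (row p) ∈ Ideal.span ((X : Fin n → S) '' {y | y ∈ A (row p) ∧ y < var p})
        rcases (hlt q p).1 hq with h | ⟨h, h'⟩
        · rw [z_gt q _ h]; exact zero_mem _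
        · rw [← h, z_row]
          exact Ideal.subset_span ⟨var q, ⟨h ▸ hvar q, h'⟩, rfl⟩
      have := hle hg
      rw [← z_row p]
      exact this
    · rintro y ⟨hy, hyp⟩
      let q : T := ⟨toLex (row p, y), hy⟩
      have hqp : q < p := (hlt q p).2 (Or.inr ⟨rfl, hyp⟩)
      -- The Koszul combination kills the common leading entry, leaving a syzygy supported on
      -- smaller rows.
      have hmem : (X y : S) • z p - (X (var p) : S) • z q ∈
          Submodule.span S (z '' {s | (row s : ℕ) < row p}) := by
        refine gen _ _ (by simp only [map_sub, map_smul, z_syz, smul_zero, sub_zero]) fun k hk => ?_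
        simp only [Pi.sub_apply, Pi.smul_apply, smul_eq_mul]
        rcases (show row p ≤ k from hk).eq_or_lt with rfl | hk
        · rw [z_row p, show z q (row p) = X y from z_row q, mul_comm, sub_self]
        · rw [z_gt p k hk, z_gt q k hk, mul_zero, mul_zero, sub_zero]
      have hmem' : (X y : S) • z p ∈ Submodule.span S (z '' Set.Iio p) := by
        rw [← sub_add_cancel ((X y : S) • z p) ((X (var p) : S) • z q)]
        refine add_mem (Submodule.span_mono (Set.image_mono fun s hs => ?_) hmem)
          (Submodule.smul_mem _ _ (Submodule.subset_span ⟨q, hqp, rfl⟩))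
        exact (hlt s p).2 (Or.inl hs)
      obtain ⟨c', h1, h2, h3⟩ := exists_linear_combination_of_mem_span (d := 1) z_hom
        (fun k => (isHomogeneous_X K y).mul (z_hom p k)) hmem'
      exact ⟨c', h1, fun s hs => h2 s hs, h3⟩
  let e := monoEquivOfFin T rfl
  refine ⟨Fintype.card T, Matrix.of fun k l => z (e l) k, fun k l => z_hom _ _, ?_,
    z_rel.comp_orderIso e⟩
  rw [LinearMap.exact_iff, Matrix.range_mulVecLin]
  have hrange : Set.range (Matrix.of fun k l => z (e l) k).col = z '' Set.univ := by
    rw [Set.image_univ]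
    exact e.surjective.range_comp z
  rw [hrange]
  apply le_antisymm
  · intro g hg
    exact Submodule.span_mono (Set.image_mono (Set.subset_univ _))
      (gen b g hg fun k hk => absurd k.2 (by omega))
  · rw [Submodule.span_le]
    rintro _ ⟨p, -, rfl⟩
    exact z_syz p

/-- A matrix of linear forms whose columns satisfy `HasLinearRelations`. -/
structure LinearSyzygyMatrix (K : Type*) [Field K] (n : ℕ) where
  rows : ℕ
  cols : ℕ
  toMatrix : Matrix (Fin rows) (Fin cols) (MvPolynomial (Fin n) K)
  isHomogeneous : ∀ k l, (toMatrix k l).IsHomogeneous 1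
  hasLinearRelations : HasLinearRelations (K := K) (n := n) toMatrix.col

theorem linearCombination_col {R : Type*} [CommRing R] {b c : ℕ} (D : Matrix (Fin b) (Fin c) R) :
    Fintype.linearCombination R D.col = D.mulVecLin := by
  ext v k
  simp [Fintype.linearCombination_apply, Matrix.mulVec, dotProduct, Matrix.col_apply, mul_comm]

/-- The columns of each syzygy matrix again have linear relations, so the next differential can be
chosen recursively. -/
theorem HasLinearRelations.hasLinearResolution {d b : ℕ} {f : Fin b → MvPolynomial (Fin n) K}
    (hf : HasLinearRelations (K := K) (n := n) f) (hd : ∀ k, (f k).IsHomogeneous d) :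
    HasLinearResolution d (Ideal.span (Set.range f)) := by
  have hstep : ∀ M : LinearSyzygyMatrix K n, ∃ (b' : ℕ)
      (D : Matrix (Fin M.cols) (Fin b') (MvPolynomial (Fin n) K)),
      (∀ k l, (D k l).IsHomogeneous 1) ∧ Function.Exact D.mulVecLin M.toMatrix.mulVecLin ∧
      HasLinearRelations (K := K) (n := n) D.col := by
    intro M
    simpa only [linearCombination_col] using M.hasLinearRelations.exists_syzygies
  choose b' D' h1 h2 h3 using hstep
  obtain ⟨b₁, D₀, hD₀, hex, hrel⟩ := hf.exists_syzygies
  let st : ℕ → LinearSyzygyMatrix K n := fun i =>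
    Nat.rec ⟨b, b₁, D₀, hD₀, hrel⟩ (fun _ M => ⟨M.cols, b' M, D' M, h1 M, h3 M⟩) i
  refine ⟨fun i => (st i).rows, f, fun i => match i with
    | 0 => D₀
    | i + 1 => D' (st i), hd, ?_, ?_, hex, ?_⟩
  · rintro (_ | i)
    · exact hD₀
    · exact h1 (st i)
  · exact Fintype.range_linearCombination _ _
  · rintro (_ | i)
    · exact h2 (st 0)
    · exact h2 (st (i + 1))

end LinearQuotients

end TSpread

namespace TSpread

/-! ### Linear quotients for the components of I. -/

section Component

variable {K : Type*} [Field K] {t n : ℕ}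

theorem hasLinearRelations_mon {β : Type*} [Fintype β] [LinearOrder β] {m : β → Fin n →₀ ℕ} {d : ℕ}
    (hd : ∀ r, (m r).degree = d)
    (h : ∀ s r, s < r → ∃ i, m r i < m s i ∧ ∃ s' < r, m s' ≤ Finsupp.single i 1 + m r) :
    HasLinearRelations (K := K) (n := n) fun r => mon K (m r) := by
  classical
  intro r
  have hB : ∀ v ∈ m '' Set.Iio r, ∃ i, m r i < v i ∧ ∃ w ∈ m '' Set.Iio r,
      w ≤ Finsupp.single i 1 + m r := by
    rintro _ ⟨s, hs, rfl⟩
    obtain ⟨i, hi, s', hs', hb⟩ := h s r hs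
    exact ⟨i, hi, m s', ⟨s', hs', rfl⟩, hb⟩
  refine ⟨_, fun g hg => (colon_mon_eq hB).le (Submodule.mem_colon_singleton.2 ?_), ?_⟩
  · rwa [Set.image_image (mon K) m]
  · rintro x ⟨_, ⟨s, hs, rfl⟩, hle⟩
    obtain ⟨y, hy⟩ := exists_add_of_le hle
    -- Equal degrees make the cofactor y a single variable, so the relation is linear.
    have hy1 : y.degree = 1 := by
      have := congrArg Finsupp.degree hy
      simp only [map_add, hd, Finsupp.degree_single] at this
      omega
    obtain ⟨b, rfl⟩ := (Finsupp.sum_eq_one_iff y).1 hy1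
    refine ⟨Pi.single s (X b), fun k => ?_, fun k hk => ?_, ?_⟩
    · by_cases hks : k = s
      · subst hks; simpa using isHomogeneous_X K b
      · rw [Pi.single_eq_of_ne hks]; exact isHomogeneous_zero _ _ _
    · exact Pi.single_eq_of_ne (by rintro rfl; exact hk hs) _
    · rw [← Fintype.linearCombination_apply, Fintype.linearCombination_apply_single, smul_eq_mul,
        smul_eq_mul, X_mul_mon, X_mul_mon, hy, add_comm]

theorem exists_lex_greatest_minGens {I : Ideal (MvPolynomial (Fin n) K)} {w : Fin n →₀ ℕ}
    (hw : mon K w ∈ I) :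
    ∃ u ∈ minGens I, u ≤ w ∧ ∀ v ∈ minGens I, v ≤ w → toLex v ≤ toLex u := by
  have hfin : {u | u ∈ minGens I ∧ u ≤ w}.Finite := (finite_minGens I).subset fun u hu => hu.1
  obtain ⟨u, hu, hmax⟩ := hfin.exists_maximalFor toLex _ (exists_minGens_le hw)
  exact ⟨u, hu.1, hu.2, fun v hv hvw =>
    (le_total (toLex v) (toLex u)).elim id fun h => hmax ⟨hv, hvw⟩ h⟩

theorem IsTSpreadIdeal.component_eq {I : Ideal (MvPolynomial (Fin n) K)} (hI : IsTSpreadIdeal t I)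
    (j : ℕ) : component I j = Ideal.span (mon K '' {w | w.degree = j ∧ mon K w ∈ I}) := by
  apply le_antisymm
  · refine Ideal.span_le.2 ?_
    rintro f ⟨hf, hfj⟩
    refine mem_ideal_span_monomial_image.2 fun m hm => ⟨m, ⟨?_, ?_⟩, le_rfl⟩
    · exact (hfj.degree_eq_sum_deg_support hm).symm
    · exact hI.mon_mem_of_mem_support hf hm
  · refine Ideal.span_mono ?_
    rintro _ ⟨w, ⟨hw, hwI⟩, rfl⟩
    exact ⟨hwI, isHomogeneous_monomial _ hw⟩

/-- For two monomials of the same degree, a lexicographic improvement of the smaller one towards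
the larger one. -/
theorem exists_shift_of_lex_lt {w v : Fin n →₀ ℕ} (hdeg : w.degree = v.degree)
    (hlt : toLex w < toLex v) :
    ∃ i b, w i < v i ∧ v b < w b ∧
      toLex w < toLex (Finsupp.single i 1 + (w - Finsupp.single b 1)) := by
  obtain ⟨i, heq, hi⟩ := Finsupp.Lex.lt_iff.1 hlt
  replace heq : ∀ a < i, w a = v a := heq
  replace hi : w i < v i := hi
  have hex : ∃ b, v b < w b := by
    by_contra! hcon
    rw [Finsupp.degree_eq_sum, Finsupp.degree_eq_sum] at hdeg
    exact (Finset.sum_lt_sum (fun b _ => hcon b) ⟨i, Finset.mem_univ i, hi⟩).ne hdeg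
  obtain ⟨b, hb⟩ := hex
  have hib : i < b := by
    by_contra! h
    rcases h.eq_or_lt with rfl | h
    · omega
    · exact hb.ne' (heq b h)
  refine ⟨i, b, hi, hb, Finsupp.Lex.lt_iff.2 ⟨i, fun a ha => ?_, ?_⟩⟩
  · change w a = _
    simp [ha.ne', (ha.trans hib).ne']
  · change w i < (Finsupp.single i 1 + (w - Finsupp.single b 1) : Fin n →₀ ℕ) i
    simp only [Finsupp.add_apply, Finsupp.tsub_apply, Finsupp.single_apply, if_neg hib.ne', if_true]
    omega

theorem degree_single_add_tsub_single {w : Fin n →₀ ℕ} {b : Fin n} (i : Fin n) (hb : 0 < w b) :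
    (Finsupp.single i 1 + (w - Finsupp.single b 1)).degree = w.degree := by
  have h : w - Finsupp.single b 1 + Finsupp.single b 1 = w :=
    tsub_add_cancel_of_le (Finsupp.single_le_iff.2 hb)
  conv_rhs => rw [← h]
  simp only [map_add, Finsupp.degree_single]
  omega

/-- The exponent vectors of the monomials of degree `j` in `I`. This is a definition, so that it does
not inherit the divisibility order. -/
def MonomialsOfDegree (I : Ideal (MvPolynomial (Fin n) K)) (j : ℕ) : Type :=
  {w : Fin n →₀ ℕ // w.degree = j ∧ mon K w ∈ I}

theorem IsTSpreadStronglyStable.isComponentwiseLinear {I : Ideal (MvPolynomial (Fin n) K)}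
    (hI : IsTSpreadStronglyStable t I) : IsComponentwiseLinear I := by
  classical
  intro j
  let W := MonomialsOfDegree I j
  have : Finite W := ((Finsupp.finite_of_degree_eq j).subset fun w hw => hw.1 :
    {w : Fin n →₀ ℕ | w.degree = j ∧ mon K w ∈ I}.Finite).to_subtype
  let _ : Fintype W := Fintype.ofFinite W
  choose gen hgen hgen_le hgen_max using fun w : W => exists_lex_greatest_minGens w.2.2
  -- Order duals make larger generators, and then larger monomials, come first.
  let key : W → (Lex (Fin n →₀ ℕ))ᵒᵈ ×ₗ (Lex (Fin n →₀ ℕ))ᵒᵈ := fun w =>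
    toLex (OrderDual.toDual (toLex (gen w)), OrderDual.toDual (toLex w.1))
  have hkey : Function.Injective key := fun v w h => Subtype.ext
    (toLex.injective (OrderDual.toDual.injective (Prod.ext_iff.1 (toLex.injective h)).2))
  let _ : LinearOrder W := LinearOrder.lift' key hkey
  have hlt : ∀ v w : W, v < w ↔ toLex (gen w) < toLex (gen v) ∨
      gen v = gen w ∧ toLex w.1 < toLex v.1 := fun v w => by
    change key v < key w ↔ _
    rw [Prod.Lex.lt_iff]
    exact or_congr Iff.rfl (and_congr_left' (OrderDual.toDual.injective.eq_iff.trans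
      toLex.injective.eq_iff))
  have hrel : HasLinearRelations (K := K) (n := n) fun w : W => mon K w.1 := by
    refine hasLinearRelations_mon (m := fun w : W => w.1) (fun w => w.2.1) fun v w hvw => ?_
    rcases (hlt v w).1 hvw with h | ⟨h, h'⟩
    · obtain ⟨i, b, u, hu, hi, hib, hb, hlu, hle⟩ := hI.exists_exchange (hgen w) (hgen v) h
      -- A surplus x_i in w would make u divide w, although u is lex-greater than `gen w`.
      have hwi : w.1 i = gen w i := by
        refine le_antisymm ?_ (hgen_le w i)
        by_contra! hcon
        refine (hgen_max w u hu fun c => ?_).not_gt hlu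
        have h1 := hle c
        have h2 := hgen_le w c
        simp only [Finsupp.add_apply, Finsupp.tsub_apply, Finsupp.single_apply] at h1
        split_ifs at h1 <;> subst_vars <;> omega
      have hbw : 0 < w.1 b := hb.trans_le (hgen_le w b)
      have huw : u ≤ Finsupp.single i 1 + (w.1 - Finsupp.single b 1) :=
        hle.trans (add_le_add_right (tsub_le_tsub_right (hgen_le w) _) _)
      let w' : W := ⟨Finsupp.single i 1 + (w.1 - Finsupp.single b 1),
        (degree_single_add_tsub_single i hbw).trans w.2.1,
        mon_mem_of_le (mon_mem_of_mem_minGens hu) huw⟩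
      refine ⟨i, ?_, w', (hlt w' w).2 (Or.inl (hlu.trans_le (hgen_max w' u hu huw))),
        add_le_add_right tsub_le_self _⟩
      rw [hwi]
      exact hi.trans_le (hgen_le v i)
    · obtain ⟨i, b, hi, hb, hlw⟩ := exists_shift_of_lex_lt (w.2.1.trans v.2.1.symm) h'
      -- The common generator divides v, and v_b < w_b, so one x_b of w is not needed.
      have huw : gen w ≤ Finsupp.single i 1 + (w.1 - Finsupp.single b 1) := by
        intro c
        have h1 := hgen_le w c
        have h2 := hgen_le v c
        rw [h] at h2
        simp only [Finsupp.add_apply, Finsupp.tsub_apply, Finsupp.single_apply]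
        split_ifs <;> subst_vars <;> omega
      let w' : W := ⟨Finsupp.single i 1 + (w.1 - Finsupp.single b 1),
        (degree_single_add_tsub_single i (by omega)).trans w.2.1,
        mon_mem_of_le (mon_mem_of_mem_minGens (hgen w)) huw⟩
      refine ⟨i, hi, w', (hlt w' w).2 ?_, add_le_add_right tsub_le_self _⟩
      -- The new monomial may acquire a lex-greater generator; it precedes w either way.
      rcases (hgen_max w' _ (hgen w) huw).eq_or_lt with h | h
      · exact Or.inr ⟨(toLex.injective h).symm, hlw⟩
      · exact Or.inl h
  let e := monoEquivOfFin W rfl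
  have hrange : Set.range ((fun w : W => mon K w.1) ∘ e) =
      mon K '' {w | w.degree = j ∧ mon K w ∈ I} := by
    rw [e.surjective.range_comp, Set.image_eq_range]
    rfl
  rw [hI.isTSpreadIdeal.component_eq, ← hrange]
  exact (hrel.comp_orderIso e).hasLinearResolution fun k =>
    isHomogeneous_monomial _ (e k).2.1

end Component

end TSpread

theorem theorem1p3 {K : Type*} [Field K] (n t : ℕ) (I : Ideal (MvPolynomial (Fin n) K))
    (hI : TSpread.IsTSpreadStronglyStable t I) :
    (∃ l : List (Fin n →₀ ℕ), TSpread.IsLexDecreasing l ∧ TSpread.HasLinearQuotientsWrt I l) ∧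
      TSpread.IsComponentwiseLinear I :=
  ⟨hI.exists_hasLinearQuotientsWrt, hI.isComponentwiseLinear⟩
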